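/- Let $X$ and $Y$ be finite-dimensional real normed spaces, $u:X\to Y$ a linear map and $\lambda\in\mathbb{R}$. For a finite-dimensional normed space $Z$ let $\mathcal{C}_Z=\{(t,z)\in\mathbb{R}\times Z : t\ge\|z\|\}$, let $\mathcal{L}_k=\mathcal{C}_{\ell_2^k}$ be the Lorentz cones, and let $\lambda\oplus u:\mathbb{R}\times X\to\mathbb{R}\times Y$ be the map $(t,x)\mapsto(\lambda t,u(x))$. For cones $\mathcal{C}\subseteq V$ and $\mathcal{D}\subseteq W$, write $\mathrm{Pos}(\mathcal{C},\mathcal{D})$ for the set of linear maps $P:V\to W$ with $P(\mathcal{C})\subseteq\mathcal{D}$, write $\mathcal{C}^*$ for the dual cone, and put $\mathcal{C}\otimes_{\min}\mathcal{D}=\mathrm{conv}\{x\otimes y : x\in\mathcal{C},\,y\in\mathcal{D}\}$ and $\mathcal{C}\otimes_{\max}\mathcal{D}=(\mathcal{C}^*\otimes_{\min}\mathcal{D}^*)^*$. A linear map $P:V\to W$ is *Lorentz factorizable* from $\mathcal{C}$ to $\mathcal{D}$ if it lies in $$\mathrm{conv}\{BA : k\in\mathbb{N},\ A\in\mathrm{Pos}(\mathcal{C},\mathcal{L}_k),\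 B\in\mathrm{Pos}(\mathcal{L}_k,\mathcal{D})\},$$ and *Lorentz-entanglement breaking* from $\mathcal{C}$ to $\mathcal{D}$ if $(\mathrm{id}_{\mathbb{R}^{k+1}}\otimes P)(\mathcal{L}_k\otimes_{\max}\mathcal{C})\subseteq\mathcal{L}_k\otimes_{\min}\mathcal{D}$ for all $k\in\mathbb{N}$. The Hilbert-space factorization norm of a linear map $v$ between finite-dimensional normed spaces $E\to F$ is $$\gamma_2(v)=\inf\{\|v_1\|\,\|v_2\| : v=v_2v_1,\ v_1:E\to\ell_2^k,\ v_2:\ell_2^k\to F,\ k=\mathrm{rk}(v)\},$$ and the 2-dominated norm is its trace dual, $\gamma_2^*(v)=\sup\{|\mathrm{Tr}(wv)| : w:F\to E \text{ linear},\ \gamma_2(w)\le 1\}$. Then: 1. $\lambda\oplus u$ is Lorentz factorizable from $\mathcal{C}_X$ to $\mathcal{C}_Y$ if and only if $\gamma_2(u)\le\lambda$. 2. $\lambda\oplus u$ is Lorentz-entanglement breaking from $\mathcal{C}_X$ to $\mathcal{C}_Y$ if and only if $\gamma_2^*(u)\le\lambda$. -/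

import Mathlib

open scoped TensorProduct

noncomputable section

namespace LorentzCone

section Cones

variable {V W : Type*} [AddCommGroup V] [Module ℝ V] [AddCommGroup W] [Module ℝ W]

/-- The set `Pos(C, D)` of linear maps that are positive with respect to the cones `C`, `D`. -/
def Pos (C : PointedCone ℝ V) (D : PointedCone ℝ W) : Set (V →ₗ[ℝ] W) :=
  {P | ∀ x ∈ C, P x ∈ D}

end Cones

/-- The cone `C_X = {(t, x) : ‖x‖ ≤ t}` in `ℝ × X` over the normed space `X`. -/
def coneOver (X : Type*) [NormedAddCommGroup X] [NormedSpace ℝ X] : PointedCone ℝ (ℝ × X) where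
  carrier := {p | ‖p.2‖ ≤ p.1}
  add_mem' := by
    intro a b ha hb
    exact (norm_add_le _ _).trans (add_le_add ha hb)
  zero_mem' := by simp
  smul_mem' := by
    intro c p hp
    have hp' : ‖p.2‖ ≤ p.1 := hp
    change ‖(c : ℝ) • p.2‖ ≤ (c : ℝ) * p.1
    rw [norm_smul, Real.norm_of_nonneg c.2]
    exact mul_le_mul_of_nonneg_left hp' c.2

/-- The Lorentz cone `L_k = {(t, x) : ‖x‖₂ ≤ t}` in `ℝ × ℝᵏ`. -/
abbrev lorentz (k : ℕ) : PointedCone ℝ (ℝ × EuclideanSpace ℝ (Fin k)) :=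
  coneOver (EuclideanSpace ℝ (Fin k))

section Maps

variable {V W : Type*} [AddCommGroup V] [Module ℝ V] [AddCommGroup W] [Module ℝ W]

/-- Lorentz factorizable maps: the convex hull of all compositions of a positive map from `C` to
a Lorentz cone with a positive map from that Lorentz cone to `D`. -/
def LorFact (C : PointedCone ℝ V) (D : PointedCone ℝ W) : Set (V →ₗ[ℝ] W) :=
  convexHull ℝ {P | ∃ (k : ℕ) (A : V →ₗ[ℝ] ℝ × EuclideanSpace ℝ (Fin k))
    (B : ℝ × EuclideanSpace ℝ (Fin k) →ₗ[ℝ] W),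
      A ∈ Pos C (lorentz k) ∧ B ∈ Pos (lorentz k) D ∧ P = B ∘ₗ A}

/-- Lorentz-entanglement breaking maps: `id ⊗ P` sends the maximal tensor product of `L_k` and `C`
into the minimal tensor product of `L_k` and `D`, for every `k`. -/
def LorEB (C : PointedCone ℝ V) (D : PointedCone ℝ W) : Set (V →ₗ[ℝ] W) :=
  {P | ∀ k : ℕ, ∀ z ∈ PointedCone.maxTensorProduct (lorentz k) C,
    P.lTensor (ℝ × EuclideanSpace ℝ (Fin k)) z ∈ PointedCone.minTensorProduct (lorentz k) D}

end Maps

section Norms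

variable {X Y : Type*} [NormedAddCommGroup X] [NormedSpace ℝ X]
  [NormedAddCommGroup Y] [NormedSpace ℝ Y]

/-- The central map `c ⊕ u : (t, x) ↦ (c t, u x)`. -/
def centralMap (c : ℝ) (u : X →ₗ[ℝ] Y) : ℝ × X →ₗ[ℝ] ℝ × Y :=
  (c • LinearMap.id).prodMap u

/-- The numbers `‖v₁‖ ‖v₂‖` for factorizations `u = v₂ v₁` through `ℓ₂ᵏ`, where `k` is the rank
of `u`. -/
def factorizationValues (u : X →ₗ[ℝ] Y) : Set ℝ :=
  {r | ∃ (v₁ : X →L[ℝ] EuclideanSpace ℝ (Fin (Module.finrank ℝ (LinearMap.range u))))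
    (v₂ : EuclideanSpace ℝ (Fin (Module.finrank ℝ (LinearMap.range u))) →L[ℝ] Y),
      u = (v₂ : EuclideanSpace ℝ (Fin (Module.finrank ℝ (LinearMap.range u))) →ₗ[ℝ] Y) ∘ₗ
        (v₁ : X →ₗ[ℝ] EuclideanSpace ℝ (Fin (Module.finrank ℝ (LinearMap.range u)))) ∧
      r = ‖v₁‖ * ‖v₂‖}

/-- The Hilbert-space factorization norm `γ₂`. -/
def gammaTwo (u : X →ₗ[ℝ] Y) : ℝ := sInf (factorizationValues u)

/-- The numbers `|Tr (w u)|` for `w : Y → X` with `γ₂(w) ≤ 1`. -/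
def traceValues (u : X →ₗ[ℝ] Y) : Set ℝ :=
  {r | ∃ w : Y →ₗ[ℝ] X, gammaTwo w ≤ 1 ∧ r = |LinearMap.trace ℝ X (w ∘ₗ u)|}

/-- The 2-dominated norm `γ₂*`, the trace dual of `γ₂`. -/
def gammaTwoStar (u : X →ₗ[ℝ] Y) : ℝ := sSup (traceValues u)

/-- The infimum defining `γ₂` is over a set bounded below. -/
theorem factorizationValues_bddBelow (u : X →ₗ[ℝ] Y) : BddBelow (factorizationValues u) := by
  refine ⟨0, ?_⟩
  rintro r ⟨v₁, v₂, -, rfl⟩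
  positivity

/-- The infimum defining `γ₂` is over a nonempty set. -/
theorem factorizationValues_nonempty [FiniteDimensional ℝ X] (u : X →ₗ[ℝ] Y) :
    (factorizationValues u).Nonempty := by
  let e : LinearMap.range u ≃ₗ[ℝ] EuclideanSpace ℝ (Fin (Module.finrank ℝ (LinearMap.range u))) :=
    LinearEquiv.ofFinrankEq _ _ (by simp)
  refine ⟨_, LinearMap.toContinuousLinearMap (e.toLinearMap ∘ₗ u.rangeRestrict),
    LinearMap.toContinuousLinearMap ((LinearMap.range u).subtype ∘ₗ e.symm.toLinearMap), ?_, rfl⟩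
  ext x
  simp

/-- The supremum defining `γ₂*` is over a nonempty set. -/
theorem traceValues_nonempty (u : X →ₗ[ℝ] Y) : (traceValues u).Nonempty := by
  refine ⟨_, 0, ?_, rfl⟩
  refine csInf_le_of_le (b := 0) (factorizationValues_bddBelow _) ⟨0, 0, ?_, ?_⟩ zero_le_one <;>
    simp

/-- The supremum defining `γ₂*` is over a set bounded above. -/
theorem traceValues_bddAbove [FiniteDimensional ℝ X] [FiniteDimensional ℝ Y] (u : X →ₗ[ℝ] Y) :
    BddAbove (traceValues u) := by
  let T : (Y →L[ℝ] X) →ₗ[ℝ] ℝ :=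
    { toFun := fun w => LinearMap.trace ℝ X ((w : Y →ₗ[ℝ] X) ∘ₗ u)
      map_add' := by intro a b; simp [LinearMap.add_comp]
      map_smul' := by intro c a; simp [LinearMap.smul_comp] }
  let T' := LinearMap.toContinuousLinearMap T
  refine ⟨‖T'‖ * 2, ?_⟩
  rintro r ⟨w, hw, rfl⟩
  obtain ⟨s, ⟨v₁, v₂, hv, rfl⟩, hs⟩ :=
    exists_lt_of_csInf_lt (factorizationValues_nonempty w)
      (lt_of_le_of_lt hw (one_lt_two : (1 : ℝ) < 2))
  have h1 : ‖v₂.comp v₁‖ ≤ 2 :=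
    (v₂.opNorm_comp_le v₁).trans (by rw [mul_comm]; exact hs.le)
  have h2 : LinearMap.trace ℝ X (w ∘ₗ u) = T' (v₂.comp v₁) := by
    conv_lhs => rw [hv]
    rfl
  rw [h2, ← Real.norm_eq_abs]
  exact (T'.le_opNorm _).trans (mul_le_mul_of_nonneg_left h1 (norm_nonneg _))

end Norms

end LorentzCone

end

open scoped TensorProduct

noncomputable section

namespace LorentzCone

/-! ### The norm `γ₂`: compression, attainment, triangle inequality, trace bound -/

section GammaTwo

variable {X Y : Type*} [NormedAddCommGroup X] [NormedSpace ℝ X]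
  [NormedAddCommGroup Y] [NormedSpace ℝ Y]

/-! Factorizable maps. Let `A` and `B` be positive into and out of a Lorentz cone, `v = A (1, 0)`,
and `w` the vector representing the scalar coordinate of `B`. By self-duality of the cone, `v ± a`
in the cone forces `|a| ≤ |v|` in Euclidean norm. Hence `A` restricted to `X`, and the `Y`-part of
`B`, have norms at most `|v|` and `|w|` through the Hilbert space `ℝ ⊕₂ E`, so the diagonal block of
`BA` has `γ₂ ≤ |v||w|`. The scalar entry of `BA` is only `⟨w, v⟩`, but a boost `L` and its inverse
may be inserted between `B` and `A`. Boosts are symmetric and preserve the cone, so `(v, w)` becomes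
`(Lv, L⁻¹w)` with the same pairing. For interior `v`, `w` some `L` makes these vectors parallel,
which gives `γ₂ ≤ ⟨w, v⟩` (`gammaTwo_comp_le`); an `ε`-perturbation handles the boundary. The
triangle inequality for `γ₂` passes this bound to convex hulls. Conversely, an optimal `u = v₂ v₁`
with `‖v₁‖ ≤ 1` yields `c ⊕ u = (c ⊕ v₂)(1 ⊕ v₁)`.

Entanglement breaking maps. The maximal tensor product with a Lorentz cone is the set of positive
maps, and the minimal one is closed, hence cut out by functionals. So `P` is entanglement breaking
exactly when `Tr(BAP) ≥ 0` for all positive `A`, `B` (`mem_lorEB_iff_trace`). For `P = c ⊕ u` this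
trace is `c` times the scalar entry of `BA` plus a trace of `u` against its block, and the first
half turns nonnegativity into the dual norm bound. -/

theorem gammaTwo_nonneg (u : X →ₗ[ℝ] Y) : 0 ≤ gammaTwo u := by
  refine Real.sInf_nonneg ?_
  rintro r ⟨v₁, v₂, -, rfl⟩
  positivity

/-- Any factorization through a finite-dimensional Hilbert space can be compressed to one through
a Hilbert space whose dimension is the rank. -/
theorem gammaTwo_le_of_factorization {H : Type*} [NormedAddCommGroup H] [InnerProductSpace ℝ H]
    [FiniteDimensional ℝ H] (u : X →ₗ[ℝ] Y) (v₁ : X →ₗ[ℝ] H) (v₂ : H →ₗ[ℝ] Y)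
    (hu : u = v₂ ∘ₗ v₁) {a b : ℝ} (ha : 0 ≤ a) (hb : 0 ≤ b) (h₁ : ∀ x, ‖v₁ x‖ ≤ a * ‖x‖)
    (h₂ : ∀ h, ‖v₂ h‖ ≤ b * ‖h‖) : gammaTwo u ≤ a * b := by
  -- Removing `N` from the range of `v₁` makes `v₂` injective there, so the dimension left is the
  -- rank of `u`. Projecting off `N` is a contraction and does not change `v₂ v₁`.
  let N : Submodule ℝ H := LinearMap.ker v₂ ⊓ LinearMap.range v₁
  let H₁ : Submodule ℝ H := LinearMap.range v₁ ⊓ Nᗮ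
  let w₂ : H₁ →ₗ[ℝ] Y := v₂ ∘ₗ H₁.subtype
  have hmem : ∀ x, v₁ x - N.starProjection (v₁ x) ∈ H₁ := fun x =>
    ⟨Submodule.sub_mem _ ⟨x, rfl⟩ (N.starProjection_apply_mem (v₁ x)).2,
      N.sub_starProjection_mem_orthogonal (v₁ x)⟩
  let w₁ : X →ₗ[ℝ] H₁ := LinearMap.codRestrict H₁
    (v₁ - (N.starProjection : H →ₗ[ℝ] H) ∘ₗ v₁) hmem
  have hw : ∀ x, w₂ (w₁ x) = u x := by
    intro x
    have h0 : v₂ (N.starProjection (v₁ x)) = 0 := (N.starProjection_apply_mem (v₁ x)).1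
    change v₂ (v₁ x - N.starProjection (v₁ x)) = u x
    rw [map_sub, h0, hu]
    simp
  have hinj : Function.Injective w₂ := by
    rw [injective_iff_map_eq_zero]
    rintro ⟨h, hr, ho⟩ h0
    have hN : h ∈ N := ⟨h0, hr⟩
    have : inner ℝ h h = 0 := ho h hN
    exact Subtype.ext (inner_self_eq_zero.1 this)
  have hrange : LinearMap.range w₂ = LinearMap.range u := by
    apply le_antisymm
    · rintro _ ⟨⟨_, ⟨x, rfl⟩, _⟩, rfl⟩
      exact ⟨x, by rw [hu]; rfl⟩
    · rintro _ ⟨x, rfl⟩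
      exact ⟨w₁ x, hw x⟩
  have hrank : Module.finrank ℝ H₁ = Module.finrank ℝ (LinearMap.range u) := by
    rw [← LinearMap.finrank_range_of_inj hinj, hrange]
  let e := ((stdOrthonormalBasis ℝ H₁).reindex (finCongr hrank)).repr
  have hw₁ : ∀ x, ‖w₁ x‖ ≤ a * ‖x‖ := by
    intro x
    refine le_trans ?_ (h₁ x)
    change ‖v₁ x - N.starProjection (v₁ x)‖ ≤ ‖v₁ x‖
    have h4 : Nᗮ.starProjection (v₁ x) = v₁ x - N.starProjection (v₁ x) := by
      simp [Submodule.starProjection_orthogonal]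
    rw [← h4]
    exact Submodule.norm_starProjection_apply_le _ _
  have hw₂ : ∀ h, ‖w₂ h‖ ≤ b * ‖h‖ := fun h => h₂ h
  let V₁ := LinearMap.mkContinuous (e.toLinearEquiv.toLinearMap ∘ₗ w₁) a (fun x => by
    simpa using hw₁ x)
  let V₂ := LinearMap.mkContinuous (w₂ ∘ₗ e.symm.toLinearEquiv.toLinearMap) b (fun x => by
    simpa using hw₂ (e.symm x))
  have hle : ‖V₁‖ * ‖V₂‖ ≤ a * b :=
    mul_le_mul (LinearMap.mkContinuous_norm_le _ ha _) (LinearMap.mkContinuous_norm_le _ hb _)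
      (norm_nonneg _) ha
  refine (csInf_le (factorizationValues_bddBelow u) ⟨V₁, V₂, ?_, rfl⟩).trans hle
  ext x
  simp [V₁, V₂, hw]

/-- The infimum is attained: rescaling to `‖v₁‖ ≤ 1` leaves only `‖v₂‖` to minimise, over a closed
set whose sublevel sets are compact. The rescaling needs `v₁ ≠ 0`, so `u = 0` is treated apart. -/
theorem exists_factorization_of_gammaTwo_le [FiniteDimensional ℝ X] [FiniteDimensional ℝ Y]
    {u : X →ₗ[ℝ] Y} {c : ℝ} (hc : gammaTwo u ≤ c) :
    ∃ (k : ℕ) (v₁ : X →ₗ[ℝ] EuclideanSpace ℝ (Fin k)) (v₂ : EuclideanSpace ℝ (Fin k) →ₗ[ℝ] Y),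
      u = v₂ ∘ₗ v₁ ∧ (∀ x, ‖v₁ x‖ ≤ ‖x‖) ∧ ∀ h, ‖v₂ h‖ ≤ c * ‖h‖ := by
  have hc0 : 0 ≤ c := (gammaTwo_nonneg u).trans hc
  by_cases hu : u = 0
  · exact ⟨0, 0, 0, by simp [hu], by simp, fun h => by simp; positivity⟩
  set k := Module.finrank ℝ (LinearMap.range u) with hk
  let E := EuclideanSpace ℝ (Fin k)
  let S : Set ((X →L[ℝ] E) × (E →L[ℝ] Y)) :=
    {p | ‖p.1‖ ≤ 1 ∧ p.2.comp p.1 = LinearMap.toContinuousLinearMap u}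
  have hS : ∀ r ∈ factorizationValues u, ∃ p ∈ S, ‖p.2‖ = r := by
    rintro r ⟨v₁, v₂, hv, rfl⟩
    have hv' : v₂.comp v₁ = LinearMap.toContinuousLinearMap u := by
      ext x
      simp [hv]
    have h1 : ‖v₁‖ ≠ 0 := by
      intro h
      have h0 : v₁ = 0 := norm_eq_zero.1 h
      exact hu (by rw [hv, h0]; ext; simp)
    refine ⟨(‖v₁‖⁻¹ • v₁, ‖v₁‖ • v₂), ⟨?_, ?_⟩, ?_⟩
    · simp [norm_smul, h1]
    · rw [← hv']
      ext x
      simp [h1]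
    · simp [norm_smul]
  have hSc : IsClosed S := by
    have h1 : IsClosed {p : (X →L[ℝ] E) × (E →L[ℝ] Y) | ‖p.1‖ ≤ 1} :=
      isClosed_le (by fun_prop) continuous_const
    have h2 : IsClosed {p : (X →L[ℝ] E) × (E →L[ℝ] Y) |
        p.2.comp p.1 = LinearMap.toContinuousLinearMap u} :=
      isClosed_eq (continuous_snd.clm_comp continuous_fst) continuous_const
    exact h1.inter h2
  obtain ⟨r₀, hr₀⟩ := factorizationValues_nonempty u
  obtain ⟨p₀, hp₀, -⟩ := hS r₀ hr₀
  have hcomp : IsCompact (S ∩ Metric.closedBall 0 (max 1 ‖p₀.2‖)) := by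
    have := FiniteDimensional.proper ℝ ((X →L[ℝ] E) × (E →L[ℝ] Y))
    exact (isCompact_closedBall _ _).inter_left hSc
  obtain ⟨p, ⟨hpS, -⟩, hmin⟩ := hcomp.exists_isMinOn (f := fun p => ‖p.2‖)
    ⟨p₀, hp₀, by
      rw [mem_closedBall_zero_iff, Prod.norm_def]
      exact max_le_max hp₀.1 le_rfl⟩ (by fun_prop)
  have hple : ‖p.2‖ ≤ gammaTwo u := by
    refine le_csInf (factorizationValues_nonempty u) fun r hr => ?_
    obtain ⟨q, hq, rfl⟩ := hS r hr
    by_cases hle : ‖q.2‖ ≤ ‖p₀.2‖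
    · refine hmin ⟨hq, ?_⟩
      rw [mem_closedBall_zero_iff, Prod.norm_def]
      exact max_le_max hq.1 hle
    · refine le_trans (hmin ⟨hp₀, ?_⟩) (le_of_not_ge hle)
      rw [mem_closedBall_zero_iff, Prod.norm_def]
      exact max_le_max hp₀.1 le_rfl
  refine ⟨k, p.1, p.2, ?_, fun x => ?_, fun h => ?_⟩
  · ext x
    simpa using (DFunLike.congr_fun hpS.2 x).symm
  · simpa using p.1.le_of_opNorm_le hpS.1 x
  · exact p.2.le_of_opNorm_le (hple.trans hc) h

theorem exists_balanced_factorization [FiniteDimensional ℝ X] [FiniteDimensional ℝ Y]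
    {u : X →ₗ[ℝ] Y} {c : ℝ} (hc : gammaTwo u ≤ c) :
    ∃ (k : ℕ) (v₁ : X →ₗ[ℝ] EuclideanSpace ℝ (Fin k)) (v₂ : EuclideanSpace ℝ (Fin k) →ₗ[ℝ] Y),
      u = v₂ ∘ₗ v₁ ∧ (∀ x, ‖v₁ x‖ ≤ √c * ‖x‖) ∧ ∀ h, ‖v₂ h‖ ≤ √c * ‖h‖ := by
  have hc0 : 0 ≤ c := (gammaTwo_nonneg u).trans hc
  obtain ⟨k, v₁, v₂, hu, h₁, h₂⟩ := exists_factorization_of_gammaTwo_le hc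
  obtain rfl | hpos := hc0.eq_or_lt
  · refine ⟨k, 0, v₂, ?_, by simp, fun h => by simpa using h₂ h⟩
    rw [hu]
    ext x
    simpa using h₂ (v₁ x)
  have hs : √c ≠ 0 := (Real.sqrt_pos.2 hpos).ne'
  refine ⟨k, √c • v₁, (√c)⁻¹ • v₂, ?_, fun x => ?_, fun h => ?_⟩
  · rw [hu]
    ext x
    simp [hs]
  · rw [LinearMap.smul_apply, norm_smul, Real.norm_of_nonneg (Real.sqrt_nonneg c)]
    exact mul_le_mul_of_nonneg_left (h₁ x) (Real.sqrt_nonneg c)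
  · rw [LinearMap.smul_apply, norm_smul, norm_inv, Real.norm_of_nonneg (Real.sqrt_nonneg c),
      inv_mul_le_iff₀ (Real.sqrt_pos.2 hpos), ← mul_assoc, Real.mul_self_sqrt hc0]
    exact h₂ h

theorem gammaTwo_add_le [FiniteDimensional ℝ X] [FiniteDimensional ℝ Y]
    {u v : X →ₗ[ℝ] Y} {c d : ℝ} (hu : gammaTwo u ≤ c) (hv : gammaTwo v ≤ d) :
    gammaTwo (u + v) ≤ c + d := by
  have hc0 : 0 ≤ c := (gammaTwo_nonneg u).trans hu
  have hd0 : 0 ≤ d := (gammaTwo_nonneg v).trans hv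
  obtain ⟨k, u₁, u₂, rfl, hu₁, hu₂⟩ := exists_balanced_factorization hu
  obtain ⟨l, v₁, v₂, rfl, hv₁, hv₂⟩ := exists_balanced_factorization hv
  -- Factor the sum through the Hilbert direct sum. The balanced bounds add in squares, so both legs
  -- have norm at most `√(c + d)`.
  let e := WithLp.linearEquiv 2 ℝ (EuclideanSpace ℝ (Fin k) × EuclideanSpace ℝ (Fin l))
  have key := gammaTwo_le_of_factorization (u₂ ∘ₗ u₁ + v₂ ∘ₗ v₁)
    (e.symm.toLinearMap ∘ₗ u₁.prod v₁) (u₂.coprod v₂ ∘ₗ e.toLinearMap)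
    (by ext x; simp) (Real.sqrt_nonneg (c + d)) (Real.sqrt_nonneg (c + d))
    (fun x => by
      refine abs_le_of_sq_le_sq' ?_ (by positivity) |>.2
      rw [mul_pow, Real.sq_sqrt (by positivity), WithLp.prod_norm_sq_eq_of_L2]
      have h1 : ‖u₁ x‖ ^ 2 ≤ c * ‖x‖ ^ 2 := by
        have := pow_le_pow_left₀ (norm_nonneg _) (hu₁ x) 2
        rwa [mul_pow, Real.sq_sqrt hc0] at this
      have h2 : ‖v₁ x‖ ^ 2 ≤ d * ‖x‖ ^ 2 := by
        have := pow_le_pow_left₀ (norm_nonneg _) (hv₁ x) 2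
        rwa [mul_pow, Real.sq_sqrt hd0] at this
      change ‖u₁ x‖ ^ 2 + ‖v₁ x‖ ^ 2 ≤ _
      linarith)
    (fun h => by
      refine abs_le_of_sq_le_sq' ?_ (by positivity) |>.2
      rw [mul_pow, Real.sq_sqrt (by positivity), WithLp.prod_norm_sq_eq_of_L2]
      change ‖u₂ h.fst + v₂ h.snd‖ ^ 2 ≤ _
      have h1 := (norm_add_le _ _).trans (add_le_add (hu₂ h.fst) (hv₂ h.snd))
      refine (pow_le_pow_left₀ (norm_nonneg _) h1 2).trans ?_
      have e1 := Real.sq_sqrt hc0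
      have e2 := Real.sq_sqrt hd0
      nlinarith [sq_nonneg (√c * ‖h.snd‖ - √d * ‖h.fst‖)])
  rwa [Real.mul_self_sqrt (by positivity)] at key

theorem gammaTwo_smul_le [FiniteDimensional ℝ X] [FiniteDimensional ℝ Y]
    {u : X →ₗ[ℝ] Y} {c : ℝ} (hu : gammaTwo u ≤ c) (t : ℝ) : gammaTwo (t • u) ≤ |t| * c := by
  have hc0 : 0 ≤ c := (gammaTwo_nonneg u).trans hu
  obtain ⟨k, v₁, v₂, rfl, h₁, h₂⟩ := exists_factorization_of_gammaTwo_le hu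
  have key := gammaTwo_le_of_factorization (t • (v₂ ∘ₗ v₁)) v₁ (t • v₂) (by ext; simp)
    (a := 1) (b := |t| * c) zero_le_one (by positivity) (fun x => by simpa using h₁ x)
    (fun h => by
      rw [LinearMap.smul_apply, norm_smul, Real.norm_eq_abs, mul_assoc]
      exact mul_le_mul_of_nonneg_left (h₂ h) (abs_nonneg t))
  simpa using key

theorem abs_trace_le [FiniteDimensional ℝ X] [FiniteDimensional ℝ Y] (u : X →ₗ[ℝ] Y)
    {w : Y →ₗ[ℝ] X} {r : ℝ} (hw : gammaTwo w ≤ r) :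
    |LinearMap.trace ℝ X (w ∘ₗ u)| ≤ r * gammaTwoStar u := by
  have hr : 0 ≤ r := (gammaTwo_nonneg w).trans hw
  -- Dividing `w` by `r` would fail for `r = 0`; divide by `r + ε` and let `ε` tend to `0`.
  refine ge_of_tendsto (x := nhdsWithin (0 : ℝ) (Set.Ioi 0))
    (f := fun ε => (r + ε) * gammaTwoStar u) ?_ ?_
  · refine tendsto_nhdsWithin_of_tendsto_nhds ?_
    have : Continuous fun ε : ℝ => (r + ε) * gammaTwoStar u := by fun_prop
    simpa using this.tendsto 0
  · filter_upwards [self_mem_nhdsWithin] with ε hε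
    have hε' : 0 < r + ε := add_pos_of_nonneg_of_pos hr hε
    have h1 : gammaTwo ((r + ε)⁻¹ • w) ≤ 1 := by
      refine (gammaTwo_smul_le hw _).trans ?_
      rw [abs_of_pos (inv_pos.2 hε'), inv_mul_le_iff₀ hε']
      have : (0 : ℝ) < ε := hε
      linarith
    have h2 := le_csSup (traceValues_bddAbove u) ⟨_, h1, rfl⟩
    rw [LinearMap.smul_comp, map_smul, smul_eq_mul, abs_mul, abs_of_pos (inv_pos.2 hε'),
      inv_mul_le_iff₀ hε'] at h2
    exact h2

end GammaTwo

/-! ### Self-duality of the Lorentz cone and Lorentz boosts -/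

section Boost

variable {E : Type*} [NormedAddCommGroup E] [InnerProductSpace ℝ E]

theorem mem_coneOver {X : Type*} [NormedAddCommGroup X] [NormedSpace ℝ X] {p : ℝ × X} :
    p ∈ coneOver X ↔ ‖p.2‖ ≤ p.1 := Iff.rfl

theorem inner_le_mul_of_mem_coneOver {v w : ℝ × E} (hv : v ∈ coneOver E) (hw : w ∈ coneOver E) :
    0 ≤ v.1 * w.1 + inner ℝ v.2 w.2 := by
  have h1 := neg_le_of_abs_le (abs_real_inner_le_norm v.2 w.2)
  have h2 := mul_le_mul hv hw (norm_nonneg _) ((norm_nonneg _).trans hv)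
  linarith

/-- The Lorentz cone is self-dual. -/
theorem mem_coneOver_of_forall_inner {v : ℝ × E}
    (h : ∀ w ∈ coneOver E, 0 ≤ v.1 * w.1 + inner ℝ v.2 w.2) : v ∈ coneOver E := by
  have h1 := h (‖v.2‖, -v.2) (by simp [mem_coneOver])
  have h2 := h (1, 0) (by simp [mem_coneOver])
  simp only [inner_neg_right, real_inner_self_eq_norm_sq, inner_zero_right, mul_one,
    add_zero] at h1 h2
  rw [mem_coneOver]
  by_contra hlt
  push Not at hlt
  nlinarith [norm_nonneg v.2]

/-- The Euclidean pairing of `v + a` with `v - a` is nonnegative, and it expands to `|v|² - |a|²`.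
-/
theorem sq_add_norm_sq_le_of_add_sub_mem {v a : ℝ × E} (hadd : v + a ∈ coneOver E)
    (hsub : v - a ∈ coneOver E) : a.1 ^ 2 + ‖a.2‖ ^ 2 ≤ v.1 ^ 2 + ‖v.2‖ ^ 2 := by
  have h := inner_le_mul_of_mem_coneOver hadd hsub
  simp only [Prod.fst_add, Prod.fst_sub, Prod.snd_add, Prod.snd_sub, inner_add_left,
    inner_sub_right, real_inner_self_eq_norm_sq, real_inner_comm v.2 a.2] at h
  nlinarith

theorem exists_inner_eq [FiniteDimensional ℝ E] (f : ℝ × E →ₗ[ℝ] ℝ) :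
    ∃ w : ℝ × E, ∀ z, f z = w.1 * z.1 + inner ℝ w.2 z.2 := by
  refine ⟨(f (1, 0), (InnerProductSpace.toDual ℝ E).symm
    (LinearMap.toContinuousLinearMap (f ∘ₗ LinearMap.inr ℝ ℝ E))), fun z => ?_⟩
  have hz : z = z.1 • ((1 : ℝ), (0 : E)) + (0, z.2) := by ext <;> simp
  conv_lhs => rw [hz, map_add, map_smul]
  simp [mul_comm]

/-- The Lorentz boost determined by a point `p` of the hyperboloid `p₀² = 1 + ‖p'‖²`. -/
def boost (p : ℝ × E) : ℝ × E →ₗ[ℝ] ℝ × E where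
  toFun z := (p.1 * z.1 + inner ℝ p.2 z.2, z.2 + (z.1 + inner ℝ p.2 z.2 / (1 + p.1)) • p.2)
  map_add' y z := by
    ext
    · simp [inner_add_right]; ring
    · simp only [Prod.snd_add, Prod.fst_add, inner_add_right]
      module
  map_smul' c z := by
    ext
    · simp [inner_smul_right]; ring
    · simp only [Prod.smul_snd, Prod.smul_fst, inner_smul_right, smul_eq_mul, RingHom.id_apply]
      module

theorem boost_apply (p z : ℝ × E) : boost p z =
    (p.1 * z.1 + inner ℝ p.2 z.2, z.2 + (z.1 + inner ℝ p.2 z.2 / (1 + p.1)) • p.2) := rfl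

/-- This is invariance of the Lorentz form `z₀² - ‖z'‖²` under the boost. -/
theorem norm_boost_snd_sq {p : ℝ × E} (hp : 0 < p.1) (hp' : p.1 ^ 2 = 1 + ‖p.2‖ ^ 2)
    (z : ℝ × E) :
    ‖(boost p z).2‖ ^ 2 = (p.1 * z.1 + inner ℝ p.2 z.2) ^ 2 - z.1 ^ 2 + ‖z.2‖ ^ 2 := by
  have h0 : 1 + p.1 ≠ 0 := by positivity
  have hn : ‖p.2‖ ^ 2 = p.1 ^ 2 - 1 := by linarith
  rw [boost_apply, norm_add_sq_real, norm_smul, mul_pow, inner_smul_right,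
    real_inner_comm p.2 z.2, Real.norm_eq_abs, sq_abs, hn]
  field_simp
  ring

theorem boost_mem_coneOver {p z : ℝ × E} (hp : 0 < p.1) (hp' : p.1 ^ 2 = 1 + ‖p.2‖ ^ 2)
    (hz : z ∈ coneOver E) : boost p z ∈ coneOver E := by
  have hpc : p ∈ coneOver E := abs_le_of_sq_le_sq' (by linarith) hp.le |>.2
  refine abs_le_of_sq_le_sq' ?_ (inner_le_mul_of_mem_coneOver hpc hz) |>.2
  rw [norm_boost_snd_sq hp hp']
  have : ‖z.2‖ ^ 2 ≤ z.1 ^ 2 := pow_le_pow_left₀ (norm_nonneg _) hz 2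
  change _ ≤ (p.1 * z.1 + inner ℝ p.2 z.2) ^ 2
  linarith

theorem boost_neg_boost {p : ℝ × E} (hp : 0 < p.1) (hp' : p.1 ^ 2 = 1 + ‖p.2‖ ^ 2)
    (z : ℝ × E) : boost (p.1, -p.2) (boost p z) = z := by
  have h0 : 1 + p.1 ≠ 0 := by positivity
  have hn : ‖p.2‖ ^ 2 = p.1 ^ 2 - 1 := by linarith
  ext
  · simp only [boost_apply, inner_neg_left, inner_add_right, inner_smul_right,
      real_inner_self_eq_norm_sq, hn]
    field_simp
    ring
  · simp only [boost_apply, inner_neg_left, inner_add_right, inner_smul_right,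
      real_inner_self_eq_norm_sq, hn, smul_neg, add_assoc]
    rw [← sub_eq_add_neg, ← sub_smul, add_eq_left]
    convert zero_smul ℝ p.2 using 2
    field_simp
    ring

/-- Symmetry of the boost: precomposing a functional with it boosts the representing vector. -/
theorem boost_inner (p v w : ℝ × E) :
    v.1 * (boost p w).1 + inner ℝ v.2 (boost p w).2 =
      (boost p v).1 * w.1 + inner ℝ (boost p v).2 w.2 := by
  simp only [boost_apply, inner_add_right, inner_add_left, inner_smul_right, inner_smul_left,
    real_inner_comm v.2 p.2]
  simp
  ring

/-! ### From positive factorizations to Hilbert space factorizations -/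

variable {X Y : Type*} [NormedAddCommGroup X] [NormedSpace ℝ X]
  [NormedAddCommGroup Y] [NormedSpace ℝ Y]

theorem sq_add_norm_sq_map_inr_le {A : ℝ × X →ₗ[ℝ] ℝ × E} (hA : A ∈ Pos (coneOver X) (coneOver E))
    (x : X) : (A (0, x)).1 ^ 2 + ‖(A (0, x)).2‖ ^ 2 ≤
      ((A (1, 0)).1 ^ 2 + ‖(A (1, 0)).2‖ ^ 2) * ‖x‖ ^ 2 := by
  have h1 : ‖x‖ • A (1, 0) + A (0, x) ∈ coneOver E := by
    rw [← map_smul, ← map_add]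
    exact hA _ (by simp [mem_coneOver])
  have h2 : ‖x‖ • A (1, 0) - A (0, x) ∈ coneOver E := by
    rw [← map_smul, ← map_sub]
    exact hA _ (by simp [mem_coneOver])
  refine (sq_add_norm_sq_le_of_add_sub_mem h1 h2).trans (le_of_eq ?_)
  simp only [Prod.smul_fst, Prod.smul_snd, smul_eq_mul, norm_smul, norm_norm]
  ring

theorem norm_sq_map_snd_le [FiniteDimensional ℝ E] {B : ℝ × E →ₗ[ℝ] ℝ × Y}
    (hB : B ∈ Pos (coneOver E) (coneOver Y)) {w : ℝ × E}
    (hw : ∀ z, (B z).1 = w.1 * z.1 + inner ℝ w.2 z.2) (z : ℝ × E) :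
    ‖(B z).2‖ ^ 2 ≤ (w.1 ^ 2 + ‖w.2‖ ^ 2) * (z.1 ^ 2 + ‖z.2‖ ^ 2) := by
  -- Dual form of the bound for `A`: if `g` norms the `Y`-part of `B z` and `η` represents `g`
  -- composed with the `Y`-part of `B`, positivity of `B` puts `w ± η` in the cone.
  obtain ⟨g, hg, hgz⟩ := exists_dual_vector'' ℝ (B z).2
  obtain ⟨η, hη⟩ := exists_inner_eq ((g : Y →ₗ[ℝ] ℝ) ∘ₗ LinearMap.snd ℝ ℝ Y ∘ₗ B)
  have hgB : ∀ z ∈ coneOver E, |g (B z).2| ≤ (B z).1 := fun z hz =>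
    ((g.le_of_opNorm_le hg _).trans (by rw [one_mul])).trans (hB z hz)
  have hη' : ∀ z, g (B z).2 = η.1 * z.1 + inner ℝ η.2 z.2 := hη
  have h1 : w + η ∈ coneOver E := mem_coneOver_of_forall_inner fun z hz => by
    have := neg_le_of_abs_le (hgB z hz)
    rw [hw, hη'] at this
    simp only [Prod.fst_add, Prod.snd_add, inner_add_left]
    linarith
  have h2 : w - η ∈ coneOver E := mem_coneOver_of_forall_inner fun z hz => by
    have := le_of_abs_le (hgB z hz)
    rw [hw, hη'] at this
    simp only [Prod.fst_sub, Prod.snd_sub, inner_sub_left]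
    linarith
  have h3 := sq_add_norm_sq_le_of_add_sub_mem h1 h2
  refine le_trans ?_ (mul_le_mul_of_nonneg_right h3 (by positivity))
  have h4 : ‖(B z).2‖ = η.1 * z.1 + inner ℝ η.2 z.2 := by
    rw [← hη', hgz]; rfl
  have h5 := abs_real_inner_le_norm η.2 z.2
  have h6 : ‖(B z).2‖ ≤ |η.1| * |z.1| + ‖η.2‖ * ‖z.2‖ := by
    rw [h4, ← abs_mul]
    exact add_le_add (le_abs_self _) (le_of_abs_le h5)
  refine (pow_le_pow_left₀ (norm_nonneg _) h6 2).trans ?_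
  rw [← sq_abs η.1, ← sq_abs z.1]
  nlinarith [sq_nonneg (|η.1| * ‖z.2‖ - |z.1| * ‖η.2‖)]

theorem gammaTwo_comp_le_sqrt [FiniteDimensional ℝ E]
    {A : ℝ × X →ₗ[ℝ] ℝ × E} {B : ℝ × E →ₗ[ℝ] ℝ × Y}
    (hA : A ∈ Pos (coneOver X) (coneOver E)) (hB : B ∈ Pos (coneOver E) (coneOver Y))
    {w : ℝ × E} (hw : ∀ z, (B z).1 = w.1 * z.1 + inner ℝ w.2 z.2) :
    gammaTwo (LinearMap.snd ℝ ℝ Y ∘ₗ (B ∘ₗ A) ∘ₗ LinearMap.inr ℝ ℝ X) ≤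
      √((A (1, 0)).1 ^ 2 + ‖(A (1, 0)).2‖ ^ 2) * √(w.1 ^ 2 + ‖w.2‖ ^ 2) := by
  let e := WithLp.linearEquiv 2 ℝ (ℝ × E)
  have he : ∀ h : WithLp 2 (ℝ × E), ‖h‖ ^ 2 = (e h).1 ^ 2 + ‖(e h).2‖ ^ 2 := fun h => by
    rw [WithLp.prod_norm_sq_eq_of_L2, Real.norm_eq_abs, sq_abs]; rfl
  refine gammaTwo_le_of_factorization _ (e.symm.toLinearMap ∘ₗ A ∘ₗ LinearMap.inr ℝ ℝ X)
    (LinearMap.snd ℝ ℝ Y ∘ₗ B ∘ₗ e.toLinearMap) (by ext x; simp) (Real.sqrt_nonneg _)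
    (Real.sqrt_nonneg _) (fun x => ?_) (fun h => ?_)
  · refine abs_le_of_sq_le_sq' ?_ (by positivity) |>.2
    rw [mul_pow, Real.sq_sqrt (by positivity), he]
    simpa using sq_add_norm_sq_map_inr_le hA x
  · refine abs_le_of_sq_le_sq' ?_ (by positivity) |>.2
    rw [mul_pow, Real.sq_sqrt (by positivity), he]
    exact norm_sq_map_snd_le hB hw (e h)

/-- Inserting the boost and its inverse leaves `BA` unchanged. Since the Lorentz form is invariant,
the new squared Euclidean norms are twice the squared new time coordinate minus the old form. -/
theorem gammaTwo_comp_le_sqrt_boost [FiniteDimensional ℝ E]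
    {A : ℝ × X →ₗ[ℝ] ℝ × E} {B : ℝ × E →ₗ[ℝ] ℝ × Y}
    (hA : A ∈ Pos (coneOver X) (coneOver E)) (hB : B ∈ Pos (coneOver E) (coneOver Y))
    {w : ℝ × E} (hw : ∀ z, (B z).1 = w.1 * z.1 + inner ℝ w.2 z.2)
    {p : ℝ × E} (hp : 0 < p.1) (hp' : p.1 ^ 2 = 1 + ‖p.2‖ ^ 2) :
    gammaTwo (LinearMap.snd ℝ ℝ Y ∘ₗ (B ∘ₗ A) ∘ₗ LinearMap.inr ℝ ℝ X) ≤
      √(2 * (p.1 * (A (1, 0)).1 + inner ℝ p.2 (A (1, 0)).2) ^ 2 -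
          ((A (1, 0)).1 ^ 2 - ‖(A (1, 0)).2‖ ^ 2)) *
        √(2 * (p.1 * w.1 - inner ℝ p.2 w.2) ^ 2 - (w.1 ^ 2 - ‖w.2‖ ^ 2)) := by
  have hp'' : (p.1, -p.2).1 ^ 2 = 1 + ‖(p.1, -p.2).2‖ ^ 2 := by simpa using hp'
  have key := gammaTwo_comp_le_sqrt (A := boost p ∘ₗ A) (B := B ∘ₗ boost (p.1, -p.2))
    (fun x hx => boost_mem_coneOver hp hp' (hA x hx))
    (fun x hx => hB _ (boost_mem_coneOver (p := (p.1, -p.2)) hp hp'' hx))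
    (w := boost (p.1, -p.2) w) (fun z => by
      rw [← boost_inner, LinearMap.comp_apply, hw])
  have hcomp : (B ∘ₗ boost (p.1, -p.2)) ∘ₗ boost p ∘ₗ A = B ∘ₗ A := by
    refine LinearMap.ext fun x => ?_
    simp only [LinearMap.comp_apply, boost_neg_boost hp hp']
  rw [hcomp] at key
  convert key using 3
  · rw [LinearMap.comp_apply, norm_boost_snd_sq hp hp']
    simp only [boost_apply]
    ring
  · rw [norm_boost_snd_sq (p := (p.1, -p.2)) hp hp'']
    simp only [boost_apply, inner_neg_left]
    ring

theorem gammaTwo_comp_le_of_interior [FiniteDimensional ℝ E]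
    {A : ℝ × X →ₗ[ℝ] ℝ × E} {B : ℝ × E →ₗ[ℝ] ℝ × Y}
    (hA : A ∈ Pos (coneOver X) (coneOver E)) (hB : B ∈ Pos (coneOver E) (coneOver Y))
    {w : ℝ × E} (hw : ∀ z, (B z).1 = w.1 * z.1 + inner ℝ w.2 z.2)
    (hv' : ‖(A (1, 0)).2‖ < (A (1, 0)).1) (hw' : ‖w.2‖ < w.1) :
    gammaTwo (LinearMap.snd ℝ ℝ Y ∘ₗ (B ∘ₗ A) ∘ₗ LinearMap.inr ℝ ℝ X) ≤ (B (A (1, 0))).1 := by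
  rw [hw]
  set v := A (1, 0) with hv
  set c := w.1 * v.1 + inner ℝ w.2 v.2 with hc
  have hv0 := norm_nonneg v.2
  have hw0 := norm_nonneg w.2
  have hcpos : 0 < c := by
    have h1 := neg_le_of_abs_le (abs_real_inner_le_norm w.2 v.2)
    have h2 := mul_lt_mul'' hw' hv' hw0 hv0
    linarith
  obtain ⟨m, hm, hm2⟩ : ∃ m : ℝ, 0 < m ∧ m ^ 2 = v.1 ^ 2 - ‖v.2‖ ^ 2 := by
    have h : 0 < v.1 ^ 2 - ‖v.2‖ ^ 2 := by nlinarith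
    exact ⟨_, Real.sqrt_pos.2 h, Real.sq_sqrt h.le⟩
  obtain ⟨n, hn, hn2⟩ : ∃ n : ℝ, 0 < n ∧ n ^ 2 = w.1 ^ 2 - ‖w.2‖ ^ 2 := by
    have h : 0 < w.1 ^ 2 - ‖w.2‖ ^ 2 := by nlinarith
    exact ⟨_, Real.sqrt_pos.2 h, Real.sq_sqrt h.le⟩
  -- With `m`, `n` the Lorentz lengths of `v`, `w` and `J` the spatial reflection, the boost vector
  -- is `n J v + m w` divided by its Lorentz length `s`. The two squared Euclidean norms become `m c
  -- / n` and `n c / m`, with product `c²`.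
  obtain ⟨s, hs, hs2⟩ : ∃ s : ℝ, 0 < s ∧ s ^ 2 = 2 * (m * n) * (m * n + c) := by
    have h : 0 < 2 * (m * n) * (m * n + c) := by positivity
    exact ⟨_, Real.sqrt_pos.2 h, Real.sq_sqrt h.le⟩
  have hpv : s⁻¹ * (n * v.1 + m * w.1) * v.1 + inner ℝ (s⁻¹ • (m • w.2 - n • v.2)) v.2 =
      s⁻¹ * (m * (m * n + c)) := by
    simp only [inner_smul_left, inner_sub_left, real_inner_self_eq_norm_sq, RCLike.conj_to_real]
    linear_combination (-s⁻¹ * n) * hm2 - s⁻¹ * m * hc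
  have hpw : s⁻¹ * (n * v.1 + m * w.1) * w.1 - inner ℝ (s⁻¹ • (m • w.2 - n • v.2)) w.2 =
      s⁻¹ * (n * (m * n + c)) := by
    simp only [inner_smul_left, inner_sub_left, real_inner_self_eq_norm_sq, RCLike.conj_to_real,
      real_inner_comm w.2 v.2]
    linear_combination (-s⁻¹ * m) * hn2 - s⁻¹ * n * hc
  have hp' : (s⁻¹ * (n * v.1 + m * w.1)) ^ 2 = 1 + ‖s⁻¹ • (m • w.2 - n • v.2)‖ ^ 2 := by
    rw [norm_smul, mul_pow, mul_pow, norm_sub_sq_real, norm_smul, norm_smul, inner_smul_left,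
      inner_smul_right, Real.norm_of_nonneg hm.le, Real.norm_of_nonneg hn.le,
      Real.norm_of_nonneg (inv_pos.2 hs).le, RCLike.conj_to_real]
    field_simp
    linear_combination (-1) * hs2 - n ^ 2 * hm2 - m ^ 2 * hn2 - 2 * m * n * hc
  have hv1 : 0 < v.1 := hv0.trans_lt hv'
  have hw1 : 0 < w.1 := hw0.trans_lt hw'
  refine (gammaTwo_comp_le_sqrt_boost hA hB hw
    (p := (s⁻¹ * (n * v.1 + m * w.1), s⁻¹ • (m • w.2 - n • v.2))) (by positivity) hp').trans ?_
  simp only [← hv, hpv, hpw]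
  have e1 : 2 * (s⁻¹ * (m * (m * n + c))) ^ 2 - (v.1 ^ 2 - ‖v.2‖ ^ 2) = m * c / n := by
    rw [← hm2, mul_pow, inv_pow, hs2]
    field_simp
    ring
  have e2 : 2 * (s⁻¹ * (n * (m * n + c))) ^ 2 - (w.1 ^ 2 - ‖w.2‖ ^ 2) = n * c / m := by
    rw [← hn2, mul_pow, inv_pow, hs2]
    field_simp
    ring
  rw [e1, e2, ← Real.sqrt_mul (by positivity)]
  refine Real.sqrt_le_iff.2 ⟨hcpos.le, le_of_eq ?_⟩
  field_simp

/-- The diagonal block of a map factoring positively through a Lorentz cone is bounded in `γ₂` by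
its scalar block. -/
theorem gammaTwo_comp_le [FiniteDimensional ℝ E]
    {A : ℝ × X →ₗ[ℝ] ℝ × E} {B : ℝ × E →ₗ[ℝ] ℝ × Y}
    (hA : A ∈ Pos (coneOver X) (coneOver E)) (hB : B ∈ Pos (coneOver E) (coneOver Y)) :
    gammaTwo (LinearMap.snd ℝ ℝ Y ∘ₗ (B ∘ₗ A) ∘ₗ LinearMap.inr ℝ ℝ X) ≤ (B (A (1, 0))).1 := by
  obtain ⟨w, hw⟩ := exists_inner_eq (LinearMap.fst ℝ ℝ Y ∘ₗ B)
  have hw' : ∀ z, (B z).1 = w.1 * z.1 + inner ℝ w.2 z.2 := hw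
  have hwc : w ∈ coneOver E := mem_coneOver_of_forall_inner fun z hz => by
    rw [← hw']
    exact (norm_nonneg _).trans (hB z hz)
  have hvc : A (1, 0) ∈ coneOver E := hA _ (by simp [mem_coneOver])
  refine ge_of_tendsto (x := nhdsWithin (0 : ℝ) (Set.Ioi 0))
    (f := fun ε => (w.1 + ε) * ((A (1, 0)).1 + ε) + inner ℝ w.2 (A (1, 0)).2) ?_ ?_
  · refine tendsto_nhdsWithin_of_tendsto_nhds ?_
    have : Continuous fun ε : ℝ =>
      (w.1 + ε) * ((A (1, 0)).1 + ε) + inner ℝ w.2 (A (1, 0)).2 := by fun_prop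
    simpa [hw'] using this.tendsto 0
  · filter_upwards [self_mem_nhdsWithin] with ε hε
    have hε' : 0 < ε := hε
    -- Adding `ε` to the scalar entry pushes `v` and `w` into the interior without changing the
    -- diagonal block of `BA`.
    let Aε : ℝ × X →ₗ[ℝ] ℝ × E := A + ε • (LinearMap.inl ℝ ℝ E ∘ₗ LinearMap.fst ℝ ℝ X)
    let Bε : ℝ × E →ₗ[ℝ] ℝ × Y := B + ε • (LinearMap.inl ℝ ℝ Y ∘ₗ LinearMap.fst ℝ ℝ E)
    have hAv : ∀ z, Aε z = ((A z).1 + ε * z.1, (A z).2) := fun z => by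
      ext <;> simp [Aε]
    have hBv : ∀ z, Bε z = ((B z).1 + ε * z.1, (B z).2) := fun z => by
      ext <;> simp [Bε]
    have hAε : Aε ∈ Pos (coneOver X) (coneOver E) := fun z hz => by
      rw [hAv, mem_coneOver]
      have h1 := mul_nonneg hε'.le ((norm_nonneg _).trans hz)
      exact (hA z hz).trans (le_add_of_nonneg_right h1)
    have hBε : Bε ∈ Pos (coneOver E) (coneOver Y) := fun z hz => by
      rw [hBv, mem_coneOver]
      have h1 := mul_nonneg hε'.le ((norm_nonneg _).trans hz)
      exact (hB z hz).trans (le_add_of_nonneg_right h1)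
    have key := gammaTwo_comp_le_of_interior hAε hBε (w := (w.1 + ε, w.2))
      (fun z => by rw [hBv, hw']; ring)
      (by rw [hAv]; simpa using lt_add_of_le_of_pos hvc hε')
      (lt_add_of_le_of_pos hwc hε')
    have hcomp : LinearMap.snd ℝ ℝ Y ∘ₗ (Bε ∘ₗ Aε) ∘ₗ LinearMap.inr ℝ ℝ X =
        LinearMap.snd ℝ ℝ Y ∘ₗ (B ∘ₗ A) ∘ₗ LinearMap.inr ℝ ℝ X := by
      refine LinearMap.ext fun x => ?_
      simp [hAv, hBv]
    rw [hcomp] at key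
    refine key.trans (le_of_eq ?_)
    rw [hBv, hAv, hw']
    simp only
    ring

/-- Central maps dominating `γ₂` factor positively through a single Lorentz cone. -/
theorem exists_pos_factorization [FiniteDimensional ℝ X] [FiniteDimensional ℝ Y]
    {u : X →ₗ[ℝ] Y} {c : ℝ} (h : gammaTwo u ≤ c) :
    ∃ (k : ℕ) (A : ℝ × X →ₗ[ℝ] ℝ × EuclideanSpace ℝ (Fin k))
      (B : ℝ × EuclideanSpace ℝ (Fin k) →ₗ[ℝ] ℝ × Y),
      A ∈ Pos (coneOver X) (lorentz k) ∧ B ∈ Pos (lorentz k) (coneOver Y) ∧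
        centralMap c u = B ∘ₗ A := by
  have hc0 : 0 ≤ c := (gammaTwo_nonneg u).trans h
  obtain ⟨k, v₁, v₂, rfl, h₁, h₂⟩ := exists_factorization_of_gammaTwo_le h
  refine ⟨k, centralMap 1 v₁, centralMap c v₂, fun x hx => ?_, fun x hx => ?_, ?_⟩
  · rw [mem_coneOver]
    simpa [centralMap] using (h₁ x.2).trans hx
  · rw [mem_coneOver]
    simpa [centralMap] using (h₂ x.2).trans (mul_le_mul_of_nonneg_left hx hc0)
  · ext <;> simp [centralMap]

/-- `c ⊕ u` is Lorentz factorizable if and only if `γ₂(u) ≤ c`. -/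
theorem centralMap_mem_lorFact_iff [FiniteDimensional ℝ X] [FiniteDimensional ℝ Y]
    (u : X →ₗ[ℝ] Y) (c : ℝ) :
    centralMap c u ∈ LorFact (coneOver X) (coneOver Y) ↔ gammaTwo u ≤ c := by
  constructor
  · intro h
    let S : Set (ℝ × X →ₗ[ℝ] ℝ × Y) :=
      {P | gammaTwo (LinearMap.snd ℝ ℝ Y ∘ₗ P ∘ₗ LinearMap.inr ℝ ℝ X) ≤ (P (1, 0)).1}
    have hS : Convex ℝ S := by
      intro P hP Q hQ a b ha hb _
      have h1 := gammaTwo_add_le (gammaTwo_smul_le hP a) (gammaTwo_smul_le hQ b)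
      rw [abs_of_nonneg ha, abs_of_nonneg hb] at h1
      simpa [S, LinearMap.add_comp, LinearMap.comp_add, LinearMap.smul_comp,
        LinearMap.comp_smul] using h1
    have hmem : centralMap c u ∈ S := by
      refine convexHull_min ?_ hS h
      rintro P ⟨k, A, B, hA, hB, rfl⟩
      exact gammaTwo_comp_le hA hB
    have hu : LinearMap.snd ℝ ℝ Y ∘ₗ centralMap c u ∘ₗ LinearMap.inr ℝ ℝ X = u := by
      ext x
      simp [centralMap]
    have h2 : gammaTwo (LinearMap.snd ℝ ℝ Y ∘ₗ centralMap c u ∘ₗ LinearMap.inr ℝ ℝ X) ≤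
      (centralMap c u (1, 0)).1 := hmem
    rw [hu] at h2
    simpa [centralMap] using h2
  · exact fun h => subset_convexHull ℝ _ (exists_pos_factorization h)

end Boost

/-! ### Closedness of the minimal tensor product -/

section ClosedCones

theorem isCompact_convexHull {E : Type*} [NormedAddCommGroup E] [NormedSpace ℝ E]
    [FiniteDimensional ℝ E] {s : Set E} (hs : IsCompact s) : IsCompact (convexHull ℝ s) := by
  obtain rfl | ⟨x₀, hx₀⟩ := s.eq_empty_or_nonempty
  · simp
  -- By Carathéodory, `dim E + 1` points suffice, so the hull is a continuous image of a compact
  -- set. Unused slots get weight `0` and the dummy point `x₀`.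
  let ι := Fin (Module.finrank ℝ E + 1)
  let g : (ι → ℝ) × (ι → E) → E := fun p => ∑ i, p.1 i • p.2 i
  have hg : Continuous g := by fun_prop
  have himg : convexHull ℝ s = g '' (stdSimplex ℝ ι ×ˢ Set.univ.pi fun _ => s) := by
    apply Set.Subset.antisymm
    · intro x hx
      obtain ⟨κ, _, z, w, hz, hind, hw, hsum, rfl⟩ := eq_pos_convex_span_of_mem_convexHull hx
      have hcard : Fintype.card κ ≤ Fintype.card ι := by
        rw [Fintype.card_fin]
        exact hind.card_le_finrank_succ.trans (Nat.succ_le_succ (Submodule.finrank_le _))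
      obtain ⟨f⟩ := Function.Embedding.nonempty_of_card_le hcard
      have hout : ∀ i, i ∉ Set.range f → Function.extend f w 0 i = 0 := fun i hi =>
        Function.extend_apply' _ _ _ hi
      refine ⟨(Function.extend f w 0, Function.extend f z fun _ => x₀), ⟨⟨fun i => ?_, ?_⟩, ?_⟩, ?_⟩
      · by_cases hi : i ∈ Set.range f
        · obtain ⟨j, rfl⟩ := hi
          simpa [f.injective.extend_apply] using (hw j).le
        · exact (hout i hi).ge
      · rw [← hsum]
        refine (Fintype.sum_of_injective f f.injective _ _ hout fun i => ?_).symm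
        simp [f.injective.extend_apply]
      · intro i _
        by_cases hi : i ∈ Set.range f
        · obtain ⟨j, rfl⟩ := hi
          simpa [f.injective.extend_apply] using hz ⟨j, rfl⟩
        · simpa [Function.extend_apply' _ _ _ hi] using hx₀
      · refine (Fintype.sum_of_injective f f.injective _ _ (fun i hi => ?_) fun i => ?_).symm
        · simp [hout i hi]
        · simp [f.injective.extend_apply]
    · rintro _ ⟨⟨w, z⟩, ⟨⟨hw, hsum⟩, hz⟩, rfl⟩
      exact (convex_convexHull ℝ s).sum_mem (fun i _ => hw i) hsum
        fun i _ => subset_convexHull ℝ s (hz i trivial)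
  rw [himg]
  exact ((isCompact_stdSimplex ℝ ι).prod (isCompact_univ_pi fun _ => hs)).image hg

/-- The functional `φ` keeps the compact base away from `0`: the cone consists of the `z` with `φ z
≥ 0` and `z = φ z • k` for some `k` in the compact convex hull. Projection along a compact factor is
closed. -/
theorem isClosed_hull {E : Type*} [NormedAddCommGroup E] [NormedSpace ℝ E]
    [FiniteDimensional ℝ E] {s : Set E} (hs : IsCompact s) (φ : E →ₗ[ℝ] ℝ)
    (hφ : ∀ x ∈ s, φ x = 1) : IsClosed (PointedCone.hull ℝ s : Set E) := by
  obtain rfl | ⟨x₀, hx₀⟩ := s.eq_empty_or_nonempty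
  · simp [PointedCone.hull]
  have hφc : Continuous φ := φ.continuous_of_finiteDimensional
  have hK := isCompact_convexHull hs
  have hsub : convexHull ℝ s ⊆ (PointedCone.hull ℝ s : Set E) :=
    convexHull_min PointedCone.subset_hull (PointedCone.convex _)
  have heq : (PointedCone.hull ℝ s : Set E) =
      {z | 0 ≤ φ z} ∩ Prod.fst '' {p : E × convexHull ℝ s | p.1 = φ p.1 • (p.2 : E)} := by
    apply Set.Subset.antisymm
    · intro z hz
      suffices h : 0 ≤ φ z ∧ ∃ k ∈ convexHull ℝ s, z = φ z • k by
        obtain ⟨h0, k, hk, hzk⟩ := h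
        exact ⟨h0, (z, ⟨k, hk⟩), hzk, rfl⟩
      induction hz using Submodule.span_induction with
      | mem z hz => exact ⟨by simp [hφ z hz], z, subset_convexHull ℝ s hz, by simp [hφ z hz]⟩
      | zero => exact ⟨by simp, x₀, subset_convexHull ℝ s hx₀, by simp⟩
      | add a b _ _ ha hb =>
        obtain ⟨ha0, k, hk, hak⟩ := ha
        obtain ⟨hb0, l, hl, hbl⟩ := hb
        rw [map_add]
        refine ⟨add_nonneg ha0 hb0, ?_⟩
        obtain h0 | hpos := (add_nonneg ha0 hb0).eq_or_lt
        · have ha1 : φ a = 0 := by linarith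
          have hb1 : φ b = 0 := by linarith
          rw [ha1, zero_smul] at hak
          rw [hb1, zero_smul] at hbl
          exact ⟨k, hk, by rw [← h0, hak, hbl]; simp⟩
        · refine ⟨(φ a / (φ a + φ b)) • k + (φ b / (φ a + φ b)) • l,
            convex_convexHull ℝ s hk hl (by positivity) (by positivity) (by field_simp), ?_⟩
          rw [smul_add, smul_smul, smul_smul, mul_div_cancel₀ _ hpos.ne',
            mul_div_cancel₀ _ hpos.ne', ← hak, ← hbl]
      | smul t z _ hz =>
        obtain ⟨h0, k, hk, hzk⟩ := hz
        have ht : φ (t • z) = t.1 * φ z := φ.map_smul t.1 z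
        rw [ht]
        refine ⟨mul_nonneg t.2 h0, k, hk, ?_⟩
        rw [mul_smul, ← hzk]
        rfl
    · rintro _ ⟨h0, ⟨z, k⟩, hz, rfl⟩
      have hz' : z = φ z • (k : E) := hz
      change z ∈ PointedCone.hull ℝ s
      rw [hz']
      exact PointedCone.smul_mem _ h0 (hsub k.2)
  rw [heq]
  have : CompactSpace (convexHull ℝ s) := isCompact_iff_compactSpace.1 hK
  refine (isClosed_le continuous_const hφc).inter (isClosedMap_fst_of_compactSpace _ ?_)
  exact isClosed_eq (by fun_prop) (by fun_prop)

theorem mem_hull_of_forall_dual {E : Type*} [NormedAddCommGroup E] [NormedSpace ℝ E]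
    [FiniteDimensional ℝ E] {s : Set E} (hs : IsCompact s) (φ : E →ₗ[ℝ] ℝ)
    (hφ : ∀ x ∈ s, φ x = 1) {z : E}
    (h : ∀ f : E →ₗ[ℝ] ℝ, (∀ x ∈ s, 0 ≤ f x) → 0 ≤ f z) : z ∈ PointedCone.hull ℝ s := by
  by_contra hz
  let C : ProperCone ℝ E := ⟨PointedCone.hull ℝ s, isClosed_hull hs φ hφ⟩
  obtain ⟨f, hf, hfz⟩ := C.hyperplane_separation_point (x₀ := z) hz
  exact absurd (h f fun x hx => hf x (PointedCone.subset_hull hx)) (not_le.2 hfz)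

variable {X Y : Type*} [NormedAddCommGroup X] [NormedSpace ℝ X] [FiniteDimensional ℝ X]
  [NormedAddCommGroup Y] [NormedSpace ℝ Y] [FiniteDimensional ℝ Y]

theorem exists_smul_eq_of_mem_coneOver {X : Type*} [NormedAddCommGroup X] [NormedSpace ℝ X]
    {p : ℝ × X} (hp : ‖p.2‖ ≤ p.1) :
    ∃ x ∈ Metric.closedBall (0 : X) 1, p = p.1 • ((1 : ℝ), x) := by
  obtain h0 | hpos := ((norm_nonneg _).trans hp).eq_or_lt
  · refine ⟨0, by simp, ?_⟩
    rw [← h0] at hp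
    ext
    · simp
    · simpa using hp
  · refine ⟨p.1⁻¹ • p.2, ?_, ?_⟩
    · rw [mem_closedBall_zero_iff, norm_smul, norm_inv, Real.norm_of_nonneg hpos.le]
      exact (inv_mul_le_iff₀ hpos).2 (by simpa using hp)
    · ext
      · simp
      · simp [hpos.ne']

/-- The minimal tensor product of two cones over finite-dimensional normed spaces is its own
bidual. -/
theorem mem_minTensorProduct_of_forall_dual {z : (ℝ × X) ⊗[ℝ] (ℝ × Y)}
    (h : ∀ f : (ℝ × X) ⊗[ℝ] (ℝ × Y) →ₗ[ℝ] ℝ,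
      (∀ x ∈ coneOver X, ∀ y ∈ coneOver Y, 0 ≤ f (x ⊗ₜ y)) → 0 ≤ f z) :
    z ∈ PointedCone.minTensorProduct (coneOver X) (coneOver Y) := by
  -- Coordinates supply a norm on the tensor product. The compact base is the image of the tensors
  -- `(1, x) ⊗ (1, y)` with `x`, `y` in the unit balls.
  let e := (Module.finBasis ℝ ((ℝ × X) ⊗[ℝ] (ℝ × Y))).equivFun
  let b := (TensorProduct.mk ℝ (ℝ × X) (ℝ × Y)).compr₂ e.toLinearMap
  have hb : Continuous fun p : (ℝ × X) × (ℝ × Y) => b p.1 p.2 := by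
    let b' := LinearMap.toContinuousLinearMap (LinearMap.toContinuousLinearMap.toLinearMap ∘ₗ b)
    have : Continuous fun p : (ℝ × X) × (ℝ × Y) => b' p.1 p.2 := by fun_prop
    exact this
  let s := (fun p : X × Y => b (1, p.1) (1, p.2)) ''
    (Metric.closedBall 0 1 ×ˢ Metric.closedBall 0 1)
  have hs : IsCompact s := by
    have := FiniteDimensional.proper ℝ X
    have := FiniteDimensional.proper ℝ Y
    refine ((isCompact_closedBall _ _).prod (isCompact_closedBall _ _)).image ?_
    exact hb.comp (f := fun p : X × Y => (((1 : ℝ), p.1), ((1 : ℝ), p.2))) (by fun_prop)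
  let φ : (Fin (Module.finrank ℝ ((ℝ × X) ⊗[ℝ] (ℝ × Y))) → ℝ) →ₗ[ℝ] ℝ :=
    (TensorProduct.lid ℝ ℝ).toLinearMap ∘ₗ
      TensorProduct.map (LinearMap.fst ℝ ℝ X) (LinearMap.fst ℝ ℝ Y) ∘ₗ e.symm.toLinearMap
  have hφ : ∀ x ∈ s, φ x = 1 := by
    rintro _ ⟨⟨x, y⟩, -, rfl⟩
    simp [φ, b]
  have key : e z ∈ PointedCone.hull ℝ s := by
    refine mem_hull_of_forall_dual hs φ hφ fun f hf => h (f ∘ₗ e.toLinearMap) fun x hx y hy => ?_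
    obtain ⟨x', hx', hxx⟩ := exists_smul_eq_of_mem_coneOver hx
    obtain ⟨y', hy', hyy⟩ := exists_smul_eq_of_mem_coneOver hy
    rw [hxx, hyy, TensorProduct.smul_tmul_smul, map_smul, smul_eq_mul]
    exact mul_nonneg (mul_nonneg ((norm_nonneg _).trans hx) ((norm_nonneg _).trans hy))
      (hf _ ⟨(x', y'), ⟨hx', hy'⟩, rfl⟩)
  have hle : ∀ t ∈ PointedCone.hull ℝ s,
      e.symm t ∈ PointedCone.minTensorProduct (coneOver X) (coneOver Y) := by
    intro t ht
    induction ht using Submodule.span_induction with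
    | mem t ht =>
      obtain ⟨⟨x, y⟩, ⟨hx, hy⟩, rfl⟩ := ht
      rw [mem_closedBall_zero_iff] at hx hy
      have : e.symm (b (1, x) (1, y)) = ((1 : ℝ), x) ⊗ₜ[ℝ] ((1 : ℝ), y) := by simp [b]
      simp only [this]
      exact PointedCone.tmul_mem_minTensorProduct hx hy
    | zero => simp
    | add a b _ _ ha hb => rw [map_add]; exact add_mem ha hb
    | smul c t _ ht =>
      have : e.symm (c • t) = c • e.symm t := e.symm.map_smul c.1 t
      rw [this]
      exact Submodule.smul_mem _ c ht
  simpa using hle _ key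

end ClosedCones

/-! ### Tensors as maps and trace duality -/

section TraceDuality

theorem trace_prod_eq {X : Type*} [AddCommGroup X] [Module ℝ X] [FiniteDimensional ℝ X]
    (M : ℝ × X →ₗ[ℝ] ℝ × X) : LinearMap.trace ℝ (ℝ × X) M = (M (1, 0)).1 +
      LinearMap.trace ℝ X (LinearMap.snd ℝ ℝ X ∘ₗ M ∘ₗ LinearMap.inr ℝ ℝ X) := by
  have h : M = (LinearMap.inl ℝ ℝ X ∘ₗ LinearMap.fst ℝ ℝ X) ∘ₗ M +
      (LinearMap.inr ℝ ℝ X ∘ₗ LinearMap.snd ℝ ℝ X) ∘ₗ M := by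
    refine LinearMap.ext fun x => ?_
    ext <;> simp
  have h1 : LinearMap.trace ℝ ℝ (LinearMap.fst ℝ ℝ X ∘ₗ M ∘ₗ LinearMap.inl ℝ ℝ X) =
      (M (1, 0)).1 := by
    rw [LinearMap.trace_eq_matrix_trace ℝ (Module.Basis.singleton Unit ℝ)]
    simp [Matrix.trace, LinearMap.toMatrix_apply]
  conv_lhs => rw [h]
  rw [map_add, LinearMap.comp_assoc, LinearMap.comp_assoc, LinearMap.trace_comp_comm',
    LinearMap.trace_comp_comm' _ (LinearMap.inr ℝ ℝ X), LinearMap.comp_assoc,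
    LinearMap.comp_assoc, h1]

variable {E : Type*} [NormedAddCommGroup E] [InnerProductSpace ℝ E]

variable (E) in
/-- The Euclidean inner product of `ℝ × E`. -/
def pairing : ℝ × E →ₗ[ℝ] Module.Dual ℝ (ℝ × E) :=
  LinearMap.mk₂ ℝ (fun v w => v.1 * w.1 + inner ℝ v.2 w.2)
    (fun a b w => by simp [inner_add_left]; ring)
    (fun c a w => by simp [inner_smul_left]; ring)
    (fun v a b => by simp [inner_add_right]; ring)
    (fun c v a => by simp [inner_smul_right]; ring)

theorem pairing_apply (v w : ℝ × E) : pairing E v w = v.1 * w.1 + inner ℝ v.2 w.2 := rfl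

theorem pairing_comm (v w : ℝ × E) : pairing E v w = pairing E w v := by
  rw [pairing_apply, pairing_apply, real_inner_comm, mul_comm]

theorem exists_pairing_eq [FiniteDimensional ℝ E] (f : Module.Dual ℝ (ℝ × E)) :
    ∃ w, pairing E w = f := by
  obtain ⟨w, hw⟩ := exists_inner_eq f
  exact ⟨w, LinearMap.ext fun z => (hw z).symm⟩

theorem pairing_injective : Function.Injective (pairing E) := by
  rw [injective_iff_map_eq_zero]
  intro v hv
  have h : pairing E v v = 0 := by rw [hv]; rfl
  rw [pairing_apply, real_inner_self_eq_norm_sq] at h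
  have h1 : v.1 = 0 := by nlinarith [sq_nonneg ‖v.2‖]
  have h2 : v.2 = 0 := by
    rw [h1] at h
    simpa using h
  exact Prod.ext h1 h2

variable (E) in
/-- The self-duality of `ℝ × E`. -/
def pairingEquiv [FiniteDimensional ℝ E] : (ℝ × E) ≃ₗ[ℝ] Module.Dual ℝ (ℝ × E) :=
  LinearEquiv.ofBijective (pairing E) ⟨pairing_injective, exists_pairing_eq⟩

theorem pairing_pairingEquiv_symm [FiniteDimensional ℝ E] (f : Module.Dual ℝ (ℝ × E)) :
    pairing E ((pairingEquiv E).symm f) = f :=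
  (pairingEquiv E).apply_symm_apply f

variable {W W' : Type*} [AddCommGroup W] [Module ℝ W] [AddCommGroup W'] [Module ℝ W']

variable (E W) in
/-- Tensors in `(ℝ × E) ⊗ W` as maps `ℝ × E → W`. -/
def tensorToHom : (ℝ × E) ⊗[ℝ] W →ₗ[ℝ] (ℝ × E →ₗ[ℝ] W) :=
  dualTensorHom ℝ (ℝ × E) W ∘ₗ (pairing E).rTensor W

theorem tensorToHom_tmul (v : ℝ × E) (x : W) (p : ℝ × E) :
    tensorToHom E W (v ⊗ₜ x) p = pairing E v p • x := by
  simp [tensorToHom]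

theorem exists_tensorToHom_eq [FiniteDimensional ℝ E] (B : ℝ × E →ₗ[ℝ] W) :
    ∃ z, tensorToHom E W z = B := by
  refine ⟨(pairingEquiv E).symm.toLinearMap.rTensor W
    ((dualTensorHomEquiv ℝ (ℝ × E) W).symm B), ?_⟩
  have h : pairing E ∘ₗ (pairingEquiv E).symm.toLinearMap = LinearMap.id :=
    LinearMap.ext pairing_pairingEquiv_symm
  rw [tensorToHom, LinearMap.comp_apply, ← LinearMap.rTensor_comp_apply, h, LinearMap.rTensor_id]
  exact (dualTensorHomEquiv ℝ (ℝ × E) W).apply_symm_apply B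

theorem dualDistrib_pairing (p : ℝ × E) (ψ : Module.Dual ℝ W) (z : (ℝ × E) ⊗[ℝ] W) :
    TensorProduct.dualDistrib ℝ (ℝ × E) W (pairing E p ⊗ₜ ψ) z = ψ (tensorToHom E W z p) := by
  induction z with
  | zero => simp
  | add a b ha hb => simp [ha, hb]
  | tmul v x => simp [tensorToHom_tmul, pairing_comm p v]

/-- By linearity it suffices to check pure tensors, where the composite has rank at most one. This
converts a test functional `f` on `(id ⊗ P) z` into `Tr(BAP)`. -/
theorem apply_lTensor_eq_trace [FiniteDimensional ℝ W] (f : (ℝ × E) ⊗[ℝ] W' →ₗ[ℝ] ℝ)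
    (A : W' →ₗ[ℝ] ℝ × E) (hA : ∀ v y, pairing E v (A y) = f (v ⊗ₜ y)) (P : W →ₗ[ℝ] W')
    (z : (ℝ × E) ⊗[ℝ] W) :
    f (P.lTensor (ℝ × E) z) = LinearMap.trace ℝ W ((tensorToHom E W z ∘ₗ A) ∘ₗ P) := by
  induction z with
  | zero => simp
  | add a b ha hb => simp [ha, hb, LinearMap.add_comp]
  | tmul v x =>
    have h : (tensorToHom E W (v ⊗ₜ x) ∘ₗ A) ∘ₗ P = (pairing E v ∘ₗ A ∘ₗ P).smulRight x := by
      refine LinearMap.ext fun y => ?_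
      simp [tensorToHom_tmul]
    rw [h, LinearMap.trace_smulRight]
    simp [hA]

theorem pairing_mem_dual_iff {p : ℝ × E} :
    pairing E p ∈ PointedCone.dual (Module.Dual.eval ℝ (ℝ × E)) (coneOver E) ↔
      p ∈ coneOver E :=
  ⟨fun h => mem_coneOver_of_forall_inner fun _ hw => h hw,
    fun h _ hw => inner_le_mul_of_mem_coneOver h hw⟩

theorem mem_coneOver_of_forall_dual {X : Type*} [NormedAddCommGroup X] [NormedSpace ℝ X]
    {x : ℝ × X} (h : ∀ ψ ∈ PointedCone.dual (Module.Dual.eval ℝ (ℝ × X)) (coneOver X), 0 ≤ ψ x) :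
    x ∈ coneOver X := by
  obtain ⟨g, hg, hgx⟩ := exists_dual_vector'' ℝ x.2
  -- Since `‖g‖ ≤ 1`, the functional `(t, y) ↦ t - g y` lies in the dual cone; at `x` it equals `x.1
  -- - ‖x.2‖`.
  have h1 := h (LinearMap.fst ℝ ℝ X - (g : X →ₗ[ℝ] ℝ) ∘ₗ LinearMap.snd ℝ ℝ X) fun y hy => by
    have h2 := (le_abs_self _).trans (g.le_of_opNorm_le hg y.2)
    have hy' : ‖y.2‖ ≤ y.1 := hy
    simp
    linarith
  have hgx' : g x.2 = ‖x.2‖ := hgx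
  simp [hgx'] at h1
  exact h1

/-- The maximal tensor product with a Lorentz cone consists of the positive maps. -/
theorem mem_maxTensorProduct_iff [FiniteDimensional ℝ E] {X : Type*} [NormedAddCommGroup X]
    [NormedSpace ℝ X] {z : (ℝ × E) ⊗[ℝ] (ℝ × X)} :
    z ∈ PointedCone.maxTensorProduct (coneOver E) (coneOver X) ↔
      tensorToHom E (ℝ × X) z ∈ Pos (coneOver E) (coneOver X) := by
  rw [PointedCone.mem_maxTensorProduct]
  constructor
  · intro h p hp
    refine mem_coneOver_of_forall_dual fun ψ hψ => ?_
    rw [← dualDistrib_pairing]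
    exact h _ (pairing_mem_dual_iff.2 hp) ψ hψ
  · intro h φ hφ ψ hψ
    obtain ⟨p, rfl⟩ := exists_pairing_eq φ
    rw [dualDistrib_pairing]
    exact hψ (h p (pairing_mem_dual_iff.1 hφ))

theorem nonneg_of_mem_minTensorProduct {C : PointedCone ℝ W} {D : PointedCone ℝ W'}
    {f : W ⊗[ℝ] W' →ₗ[ℝ] ℝ} (hf : ∀ x ∈ C, ∀ y ∈ D, 0 ≤ f (x ⊗ₜ y)) {z : W ⊗[ℝ] W'}
    (hz : z ∈ PointedCone.minTensorProduct C D) : 0 ≤ f z := by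
  induction hz using Submodule.span_induction with
  | mem z hz =>
    obtain ⟨x, hx, y, hy, rfl⟩ := hz
    exact hf x hx y hy
  | zero => simp
  | add a b _ _ ha hb => rw [map_add]; exact add_nonneg ha hb
  | smul c z _ hz =>
    have : f (c • z) = c.1 * f z := f.map_smul c.1 z
    rw [this]
    exact mul_nonneg c.2 hz

variable {X Y : Type*} [NormedAddCommGroup X] [NormedSpace ℝ X] [FiniteDimensional ℝ X]
  [NormedAddCommGroup Y] [NormedSpace ℝ Y] [FiniteDimensional ℝ Y]

/-- Trace duality between Lorentz-entanglement breaking and Lorentz factorizable maps. -/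
theorem mem_lorEB_iff_trace {P : ℝ × X →ₗ[ℝ] ℝ × Y} :
    P ∈ LorEB (coneOver X) (coneOver Y) ↔
      ∀ (k : ℕ), ∀ A ∈ Pos (coneOver Y) (lorentz k), ∀ B ∈ Pos (lorentz k) (coneOver X),
        0 ≤ LinearMap.trace ℝ (ℝ × X) ((B ∘ₗ A) ∘ₗ P) := by
  constructor
  · intro hP k A hA B hB
    obtain ⟨z, rfl⟩ := exists_tensorToHom_eq B
    let f : (ℝ × EuclideanSpace ℝ (Fin k)) ⊗[ℝ] (ℝ × Y) →ₗ[ℝ] ℝ :=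
      TensorProduct.lift ((pairing _).compl₂ A)
    rw [← apply_lTensor_eq_trace f A (fun v y => by simp [f])]
    refine nonneg_of_mem_minTensorProduct (fun x hx y hy => ?_)
      (hP k z (mem_maxTensorProduct_iff.2 hB))
    exact inner_le_mul_of_mem_coneOver hx (hA y hy)
  · intro h k z hz
    refine mem_minTensorProduct_of_forall_dual fun f hf => ?_
    -- Self-duality of the Lorentz cone makes `f` nonnegative on product vectors the same as `A`
    -- positive.
    let A : ℝ × Y →ₗ[ℝ] ℝ × EuclideanSpace ℝ (Fin k) :=
      (pairingEquiv _).symm.toLinearMap ∘ₗ (TensorProduct.curry f).flip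
    have hA : ∀ v y, pairing _ v (A y) = f (v ⊗ₜ y) := fun v y => by
      rw [pairing_comm]
      simp [A, pairing_pairingEquiv_symm]
    rw [apply_lTensor_eq_trace f A hA]
    refine h k A (fun y hy => mem_coneOver_of_forall_inner fun v hv => ?_) _
      (mem_maxTensorProduct_iff.1 hz)
    rw [← pairing_apply, pairing_comm, hA]
    exact hf v hv y hy

theorem trace_comp_centralMap {Y : Type*} [NormedAddCommGroup Y] [NormedSpace ℝ Y]
    (R : ℝ × Y →ₗ[ℝ] ℝ × X) (c : ℝ) (u : X →ₗ[ℝ] Y) :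
    LinearMap.trace ℝ (ℝ × X) (R ∘ₗ centralMap c u) = c * (R (1, 0)).1 +
      LinearMap.trace ℝ X ((LinearMap.snd ℝ ℝ X ∘ₗ R ∘ₗ LinearMap.inr ℝ ℝ Y) ∘ₗ u) := by
  rw [trace_prod_eq]
  congr 1
  · have : centralMap c u (1, 0) = c • ((1 : ℝ), (0 : Y)) := by simp [centralMap]
    rw [LinearMap.comp_apply, this, map_smul]
    rfl
  · congr 1
    refine LinearMap.ext fun x => ?_
    simp [centralMap]

/-- `c ⊕ u` is Lorentz-entanglement breaking if and only if `γ₂*(u) ≤ c`. -/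
theorem centralMap_mem_lorEB_iff (u : X →ₗ[ℝ] Y) (c : ℝ) :
    centralMap c u ∈ LorEB (coneOver X) (coneOver Y) ↔ gammaTwoStar u ≤ c := by
  rw [mem_lorEB_iff_trace]
  constructor
  · intro h
    have key : ∀ w : Y →ₗ[ℝ] X, gammaTwo w ≤ 1 → 0 ≤ c + LinearMap.trace ℝ X (w ∘ₗ u) := by
      intro w hw
      obtain ⟨k, A, B, hA, hB, hBA⟩ := exists_pos_factorization hw
      have h1 := h k A hA B hB
      rw [← hBA, trace_comp_centralMap] at h1
      have h2 : LinearMap.snd ℝ ℝ X ∘ₗ centralMap 1 w ∘ₗ LinearMap.inr ℝ ℝ Y = w := by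
        ext x
        simp [centralMap]
      rw [h2] at h1
      simpa [centralMap] using h1
    refine csSup_le (traceValues_nonempty u) ?_
    rintro r ⟨w, hw, rfl⟩
    have h1 := key w hw
    have h2 := key (-w) (by simpa using gammaTwo_smul_le hw (-1))
    rw [LinearMap.neg_comp, map_neg] at h2
    exact abs_le.2 ⟨by linarith, by linarith⟩
  · intro h k A hA B hB
    rw [trace_comp_centralMap]
    -- With `r` the scalar entry of `BA`, its block has `γ₂ ≤ r`, so the trace is at least `c r - r
    -- γ₂*(u) ≥ 0`.
    have h0 := gammaTwo_comp_le hA hB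
    have h1 := neg_le_of_abs_le (abs_trace_le u h0)
    have h2 := mul_le_mul_of_nonneg_left h ((gammaTwo_nonneg _).trans h0)
    rw [LinearMap.comp_apply]
    linarith

end TraceDuality

end LorentzCone
end

theorem mainTheorem2 {X Y : Type*}
    [NormedAddCommGroup X] [NormedSpace ℝ X] [FiniteDimensional ℝ X]
    [NormedAddCommGroup Y] [NormedSpace ℝ Y] [FiniteDimensional ℝ Y]
    (u : X →ₗ[ℝ] Y) (c : ℝ) :
    (LorentzCone.centralMap c u ∈
        LorentzCone.LorFact (LorentzCone.coneOver X) (LorentzCone.coneOver Y) ↔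
      LorentzCone.gammaTwo u ≤ c) ∧
    (LorentzCone.centralMap c u ∈
        LorentzCone.LorEB (LorentzCone.coneOver X) (LorentzCone.coneOver Y) ↔
      LorentzCone.gammaTwoStar u ≤ c) :=
  ⟨LorentzCone.centralMap_mem_lorFact_iff u c, LorentzCone.centralMap_mem_lorEB_iff u c⟩
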